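/- Let $\mathbb K$ be a field and let $G$ be a finite simple graph with vertex set $\{v_1,\dots,v_\ell\}$ and edge set $E_G$. Let $\mathcal A_G=\{\ker(x_i-x_j)\mid \{v_i,v_j\}\in E_G\}$ be its graphic arrangement in $\mathbb K^\ell$. Then $\mathcal A_G$ is MAT-free if and only if $G$ admits an MAT-labeling. Here the terms are as follows. An arrangement $\mathcal A$ in a finite-dimensional vector space is a finite set of linear hyperplanes; its rank is $\operatorname{rank}(\mathcal A)=\operatorname{codim}\bigcap_{H\in\mathcal A}H$; and for $H\in\mathcal A$, $\mathcal A^{H}=\{K\cap H\mid K\in\mathcal A\setminus\{H\}\}$. An arrangement $\mathcal A$ is *MAT-free* if it is empty or there is a partition $\mathcal A=\pi_1\sqcup\dots\sqcup\pi_n$ into nonempty subsets such that for every $1\le k\le n$, writing $\mathcal A_{k-1}=\pi_1\sqcup\dots\sqcup\pi_{k-1}$ (so that $\mathcal A_0=\varnothing$): 1. $\operatorname{rank}(\pi_k)=|\pi_k|$; 2. there is no $H'\in\mathcal A_{k-1}$ with $\bigcap_{H\in\pi_k}H\subseteq H'$; 3. $|\mathcal A_{k-1}|-|(\mathcal A_{k-1}\cup\{H\})^{H}|=k-1$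 for each $H\in\pi_k$. An *MAT-labeling* of $G$ is a map $\lambda:E_G\to\mathbb Z_{>0}$ such that for every $k\ge 1$, writing $\pi_k=\lambda^{-1}(k)$ and $E_{k-1}=\lambda^{-1}(\{1,\dots,k-1\})$: 1. $\pi_k$ is a forest; 2. no edge in $E_{k-1}$ has its two endvertices connected by a path of edges in $\pi_k$ (that is, the closure of $\pi_k$ in the graphic matroid of $G$ is disjoint from $E_{k-1}$); 3. each edge $e\in\pi_k$ lies in exactly $k-1$ triangles of $G$ whose other two edges are in $E_{k-1}$. -/

import Mathlib

namespace MATFree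

section Arrangements

variable {K E : Type*} [Field K] [AddCommGroup E] [Module K E]

/-- A (central) hyperplane arrangement in `E`: a finite set of linear subspaces of
codimension one. -/
structure Arrangement (K E : Type*) [Field K] [AddCommGroup E] [Module K E] where
  hyperplanes : Set (Submodule K E)
  finite : hyperplanes.Finite
  codim_one : ∀ H ∈ hyperplanes, Module.finrank K (E ⧸ H) = 1

/-- The rank of a set of hyperplanes: the codimension of its intersection
(the intersection of the empty set being the whole space). -/
noncomputable def rank (B : Set (Submodule K E)) : ℕ :=
  Module.finrank K (E ⧸ sInf B)

/-- The localization `B_X`: the members of `B` that contain `X`. -/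
def localization (B : Set (Submodule K E)) (X : Submodule K E) : Set (Submodule K E) :=
  {H | H ∈ B ∧ X ≤ H}

/-- The restriction `B^X = {H ∩ X | H ∈ B \ B_X}`; its members are recorded as
subspaces of `E` (contained in `X`). -/
def restriction (B : Set (Submodule K E)) (X : Submodule K E) : Set (Submodule K E) :=
  (fun H => H ⊓ X) '' (B \ localization B X)

/-- For blocks `π 0, …, π (n-1)`, the union of the blocks strictly before `π k`. -/
def lowerBlocks {n : ℕ} (π : Fin n → Set (Submodule K E)) (k : Fin n) :
    Set (Submodule K E) :=
  ⋃ j, ⋃ (_ : j < k), π j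

/-- `π` is an MAT-partition of `A`. Blocks are indexed from `0`: the block `π k` here is the
`(k+1)`-st block of the partition, so the required difference in `mp3` is `k`. -/
structure IsMATPartition (A : Arrangement K E) {n : ℕ} (π : Fin n → Set (Submodule K E)) :
    Prop where
  nonempty : ∀ k, (π k).Nonempty
  disjoint : ∀ j k, j ≠ k → Disjoint (π j) (π k)
  cover : ⋃ k, π k = A.hyperplanes
  mp1 : ∀ k, rank (π k) = (π k).ncard
  mp2 : ∀ k, ¬ ∃ H' ∈ lowerBlocks π k, sInf (π k) ≤ H'
  mp3 : ∀ k, ∀ H ∈ π k,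
    ((lowerBlocks π k).ncard : ℤ) - ((restriction (lowerBlocks π k ∪ {H}) H).ncard : ℤ)
      = ((k : ℕ) : ℤ)

/-- An arrangement is MAT-free if it is empty or admits an MAT-partition. -/
def Arrangement.IsMATFree (A : Arrangement K E) : Prop :=
  A.hyperplanes = ∅ ∨ ∃ (n : ℕ) (π : Fin n → Set (Submodule K E)), IsMATPartition A π

end Arrangements

section Graphs

variable {V : Type*}

/-- The subspace `x_u = x_v` of `K^V`. -/
def diagHyperplane (K : Type*) [Field K] (u v : V) : Submodule K (V → K) :=
  LinearMap.ker ((LinearMap.proj u : (V → K) →ₗ[K] K) - (LinearMap.proj v : (V → K) →ₗ[K] K))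

theorem finrank_quotient_diagHyperplane (K : Type*) [Field K] {u v : V} (h : u ≠ v) :
    Module.finrank K ((V → K) ⧸ diagHyperplane K u v) = 1 := by
  classical
  have hs : Function.Surjective
      ((LinearMap.proj u : (V → K) →ₗ[K] K) - (LinearMap.proj v : (V → K) →ₗ[K] K)) := by
    intro c
    refine ⟨Pi.single u c, ?_⟩
    simp [Pi.single_eq_of_ne h.symm]
  have := (LinearMap.quotKerEquivOfSurjective _ hs).finrank_eq
  rw [Module.finrank_self] at this
  exact this

/-- The graphic arrangement of `G` in `K^V`: all hyperplanes `x_u = x_v` with `{u, v}` an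
edge of `G`. -/
def graphicArrangement (K : Type*) [Field K] [Finite V] (G : SimpleGraph V) :
    Arrangement K (V → K) where
  hyperplanes := {H | ∃ u v, G.Adj u v ∧ H = diagHyperplane K u v}
  finite := by
    refine (Set.finite_range (fun p : V × V => diagHyperplane K p.1 p.2)).subset ?_
    rintro H ⟨u, v, -, rfl⟩
    exact ⟨(u, v), rfl⟩
  codim_one := by
    rintro H ⟨u, v, huv, rfl⟩
    exact finrank_quotient_diagHyperplane K huv.ne

/-- The set of edges of label `k`. -/
def labelClass {G : SimpleGraph V} (lam : G.edgeSet → ℕ+) (k : ℕ+) : Set (Sym2 V) :=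
  Subtype.val '' (lam ⁻¹' {k})

/-- The set of edges of label smaller than `k`. -/
def lowerEdges {G : SimpleGraph V} (lam : G.edgeSet → ℕ+) (k : ℕ+) : Set (Sym2 V) :=
  ⋃ j, ⋃ (_ : j < k), labelClass lam j

/-- The closure of a set `F` of edges in the graphic matroid of `G`: the edges of `G` whose
two endvertices are connected by edges in `F`. -/
def edgeClosure (G : SimpleGraph V) (F : Set (Sym2 V)) : Set (Sym2 V) :=
  {e | ∃ u v, G.Adj u v ∧ e = s(u, v) ∧ (SimpleGraph.fromEdgeSet F).Reachable u v}

/-- The triangles of `G` (given by their vertex sets) that contain the edge `e` and whose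
other two edges lie in `F`. -/
def trianglesOver (G : SimpleGraph V) (F : Set (Sym2 V)) (e : Sym2 V) : Set (Finset V) :=
  {t | G.IsNClique 3 t ∧ (∀ u ∈ e, u ∈ t) ∧
    ∀ u ∈ t, ∀ v ∈ t, u ≠ v → s(u, v) ≠ e → s(u, v) ∈ F}

/-- `lam` is an MAT-labeling of `G`. -/
structure IsMATLabeling (G : SimpleGraph V) (lam : G.edgeSet → ℕ+) : Prop where
  ml1 : ∀ k, (SimpleGraph.fromEdgeSet (labelClass lam k)).IsAcyclic
  ml2 : ∀ k, edgeClosure G (labelClass lam k) ∩ lowerEdges lam k = ∅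
  ml3 : ∀ k, ∀ e ∈ labelClass lam k,
    (trianglesOver G (lowerEdges lam k) e).ncard = (k : ℕ) - 1

end Graphs

end MATFree

namespace MATFree

section Chordal

variable {V : Type*}

/-- `p 0, …, p n` is an induced path of `H`. -/
structure IsInducedPath (H : SimpleGraph V) (n : ℕ) (p : ℕ → V) : Prop where
  ne : ∀ i j, i < j → j ≤ n → p i ≠ p j
  adj_iff : ∀ i j, i < j → j ≤ n → (H.Adj (p i) (p j) ↔ j = i + 1)

/-- `p 0, …, p n` is an induced cycle of `H` of length `n + 1 ≥ 4`. -/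
structure IsInducedCycle (H : SimpleGraph V) (n : ℕ) (p : ℕ → V) : Prop where
  three_le : 3 ≤ n
  ne : ∀ i j, i < j → j ≤ n → p i ≠ p j
  adj_iff : ∀ i j, i < j → j ≤ n → (H.Adj (p i) (p j) ↔ j = i + 1 ∨ (i = 0 ∧ j = n))

/-- A graph is chordal if it has no induced cycle of length at least four. -/
def IsChordal (H : SimpleGraph V) : Prop :=
  ∀ n p, ¬ IsInducedCycle H n p

theorem isChordal_bot : IsChordal (⊥ : SimpleGraph V) := by
  intro n p h
  have h3 := h.three_le
  exact (h.adj_iff 0 1 (by omega) (by omega)).2 (Or.inl rfl)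

theorem IsInducedPath.mono {H : SimpleGraph V} {n m : ℕ} {p : ℕ → V}
    (hp : IsInducedPath H n p) (hm : m ≤ n) : IsInducedPath H m p :=
  ⟨fun i j hij hj => hp.ne i j hij (hj.trans hm),
    fun i j hij hj => hp.adj_iff i j hij (hj.trans hm)⟩

theorem IsInducedPath.shift {H : SimpleGraph V} {n : ℕ} {p : ℕ → V}
    (hp : IsInducedPath H n p) {j : ℕ} (hj : j ≤ n) :
    IsInducedPath H (n - j) (fun i => p (i + j)) :=
  ⟨fun a b hab hb => hp.ne _ _ (by omega) (by omega),
    fun a b hab hb => (hp.adj_iff _ _ (by omega) (by omega)).trans (by omega)⟩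

/-- In a chordal graph, a vertex off an induced path and adjacent to both of its ends is adjacent
to all of its vertices. -/
theorem IsChordal.adj_of_isInducedPath {H : SimpleGraph V} (hH : IsChordal H) {c : V} :
    ∀ {n : ℕ} {p : ℕ → V}, IsInducedPath H n p → (∀ i ≤ n, c ≠ p i) →
      H.Adj c (p 0) → H.Adj c (p n) → ∀ i ≤ n, H.Adj c (p i) := by
  intro n
  induction n using Nat.strong_induction_on with
  | _ n ih =>
    intro p hp hc h0 hn i hi
    rcases Nat.eq_zero_or_pos i with rfl | hi0
    · exact h0
    rcases hi.eq_or_lt with rfl | hin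
    · exact hn
    by_cases hex : ∃ j, 0 < j ∧ j < n ∧ H.Adj c (p j)
    · obtain ⟨j, hj0, hjn, hj⟩ := hex
      rcases le_total i j with hij | hij
      · exact ih j hjn (hp.mono hjn.le) (fun i hi => hc i (by omega)) h0 hj i hij
      · have := ih (n - j) (by omega) (hp.shift hjn.le) (fun i hi => hc _ (by omega))
          (by simpa using hj) (by simpa [Nat.sub_add_cancel hjn.le] using hn) (i - j) (by omega)
        simpa [Nat.sub_add_cancel hij] using this
    · exfalso
      push Not at hex
      refine hH (n + 1) (fun k => if k ≤ n then p k else c) ⟨by omega, ?_, ?_⟩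
      · intro a b hab hb
        rcases Nat.lt_or_ge n b with hbn | hbn
        · simpa [show a ≤ n by omega, show ¬ b ≤ n by omega] using (hc a (by omega)).symm
        · simpa [show a ≤ n by omega, hbn] using hp.ne a b hab hbn
      · intro a b hab hb
        rcases Nat.lt_or_ge n b with hbn | hbn
        · simp only [show a ≤ n by omega, show ¬ b ≤ n by omega, if_true, if_false]
          rw [H.adj_comm]
          constructor
          · intro h
            by_contra hne
            exact hex a (by omega) (by omega) h
          · rintro (h | h)
            · rwa [show a = n by omega]
            · rwa [h.1]
        · simp only [show a ≤ n by omega, hbn, if_true]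
          rw [hp.adj_iff a b hab hbn]
          omega

theorem IsChordal.adj_of_common {H : SimpleGraph V} (hH : IsChordal H) {u v c d : V}
    (huv : u ≠ v) (hnadj : ¬ H.Adj u v) (huc : H.Adj u c) (hvc : H.Adj v c)
    (hud : H.Adj u d) (hvd : H.Adj v d) (hcd : c ≠ d) : H.Adj c d := by
  have hp : IsInducedPath H 2 (fun i => if i = 0 then u else if i = 1 then d else v) := by
    constructor
    · intro i j hij hj
      have : (i = 0 ∧ j = 1) ∨ (i = 0 ∧ j = 2) ∨ (i = 1 ∧ j = 2) := by omega
      rcases this with ⟨rfl, rfl⟩ | ⟨rfl, rfl⟩ | ⟨rfl, rfl⟩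
      · simpa using hud.ne
      · simpa using huv
      · simpa using hvd.ne'
    · intro i j hij hj
      have : (i = 0 ∧ j = 1) ∨ (i = 0 ∧ j = 2) ∨ (i = 1 ∧ j = 2) := by omega
      rcases this with ⟨rfl, rfl⟩ | ⟨rfl, rfl⟩ | ⟨rfl, rfl⟩
      · simpa using hud
      · simpa using hnadj
      · simpa using hvd.symm
  have := hH.adj_of_isInducedPath hp (c := c) (fun i hi => by
    have : i = 0 ∨ i = 1 ∨ i = 2 := by omega
    rcases this with rfl | rfl | rfl
    · simpa using huc.ne'
    · simpa using hcd
    · simpa using hvc.ne') (by simpa using huc.symm) (by simpa using hvc.symm) 1 (by omega)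
  simpa using this

/-- In a chordal graph without cliques of size `d + 2`, two distinct nonadjacent vertices have at
most `d` common neighbours. -/
theorem IsChordal.ncard_commonNeighbors_le [Finite V] {H : SimpleGraph V} (hH : IsChordal H)
    {d : ℕ} (hfree : H.CliqueFree (d + 2)) {u v : V} (huv : u ≠ v) (hnadj : ¬ H.Adj u v) :
    (H.commonNeighbors u v).ncard ≤ d := by
  classical
  by_contra hlt
  push Not at hlt
  have hfin := (H.commonNeighbors u v).toFinite
  refine hfree.mono (show d + 2 ≤ (H.commonNeighbors u v).ncard + 1 by omega)
    (insert u hfin.toFinset) ⟨?_, ?_⟩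
  · rw [Finset.coe_insert, hfin.coe_toFinset, SimpleGraph.isClique_insert]
    refine ⟨?_, fun b hb _ => hb.1⟩
    intro a ha b hb hab
    exact hH.adj_of_common huv hnadj ha.1 ha.2 hb.1 hb.2 hab
  · rw [Finset.card_insert_of_notMem, Set.ncard_eq_toFinset_card _ hfin]
    simp [SimpleGraph.mem_commonNeighbors]

theorem IsInducedCycle.rotate {H : SimpleGraph V} {n : ℕ} {p : ℕ → V}
    (hp : IsInducedCycle H n p) :
    IsInducedCycle H n (fun i => if i < n then p (i + 1) else p 0) := by
  have h3 := hp.three_le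
  refine ⟨h3, ?_, ?_⟩
  · intro i j hij hj
    rcases hj.eq_or_lt with rfl | hjn
    · simpa [hij] using (hp.ne 0 (i + 1) (by omega) (by omega)).symm
    · simpa [hjn, hij.trans hjn] using hp.ne (i + 1) (j + 1) (by omega) (by omega)
  · intro i j hij hj
    rcases hj.eq_or_lt with rfl | hjn
    · simp only [hij, lt_irrefl, if_true, if_false]
      rw [H.adj_comm, hp.adj_iff 0 (i + 1) (by omega) (by omega)]
      simp only [true_and, and_true, zero_add, Nat.add_eq_right]
      rw [or_comm, eq_comm (a := j)]
    · simp only [hjn, hij.trans hjn, if_true]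
      rw [hp.adj_iff (i + 1) (j + 1) (by omega) (by omega)]
      omega

/-- An edge of an induced cycle can be rotated to close up the cycle. -/
theorem IsInducedCycle.exists_ends_eq {H : SimpleGraph V} {n : ℕ} :
    ∀ {i : ℕ} {p : ℕ → V}, IsInducedCycle H n p → i < n →
      ∃ q, IsInducedCycle H n q ∧ s(q 0, q n) = s(p i, p (i + 1)) := by
  intro i
  induction i with
  | zero =>
    intro p hp hi
    exact ⟨_, hp.rotate, by simp [hi, Sym2.eq_swap]⟩
  | succ i ih =>
    intro p hp hi
    obtain ⟨q, hq, he⟩ := ih hp.rotate (by omega)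
    exact ⟨q, hq, by simpa [hi, show i < n by omega] using he⟩

variable {H T : SimpleGraph V}

/-- If `T` is acyclic and no edge of `H` is spanned by `T`, then a triangle of `H ⊔ T` has at most
one edge in `T`. -/
theorem adj_of_triangle (hT : T.IsAcyclic) (hHT : ∀ u v, H.Adj u v → ¬ T.Reachable u v)
    {a b x : V} (hab : T.Adj a b) (hax : (H ⊔ T).Adj a x) (hbx : (H ⊔ T).Adj b x) :
    H.Adj a x ∧ H.Adj b x := by
  rw [SimpleGraph.sup_adj] at hax hbx
  rcases hax with hax | hax <;> rcases hbx with hbx | hbx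
  · exact ⟨hax, hbx⟩
  · exact absurd (hab.reachable.trans hbx.reachable) (hHT _ _ hax)
  · exact absurd (hab.symm.reachable.trans hax.reachable) (hHT _ _ hbx)
  · exfalso
    refine SimpleGraph.isAcyclic_iff_forall_adj_isBridge.1 hT hab ?_
    have h1 : (T.deleteEdges {s(a, b)}).Adj a x := by
      simp [SimpleGraph.deleteEdges_adj, hax, hab.ne, hbx.ne']
    have h2 : (T.deleteEdges {s(a, b)}).Adj b x := by
      simp [SimpleGraph.deleteEdges_adj, hbx, hab.ne', hax.ne']
    exact h1.reachable.trans h2.symm.reachable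

variable [Finite V] {d : ℕ}

theorem cliqueFree_sup (hT : T.IsAcyclic) (hHT : ∀ u v, H.Adj u v → ¬ T.Reachable u v)
    (hfree : H.CliqueFree (d + 2))
    (hd : ∀ u v, T.Adj u v → (H.commonNeighbors u v).ncard = d) :
    (H ⊔ T).CliqueFree (d + 3) := by
  classical
  intro s hs
  by_cases hex : ∃ a ∈ s, ∃ b ∈ s, T.Adj a b
  · obtain ⟨a, ha, b, hb, hab⟩ := hex
    have hsub : (((s.erase a).erase b : Finset V) : Set V) ⊆ H.commonNeighbors a b := by
      intro x hx
      simp only [Finset.coe_erase, Set.mem_sdiff, Finset.mem_coe, Set.mem_singleton_iff] at hx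
      exact adj_of_triangle hT hHT hab (hs.isClique ha hx.1.1 (Ne.symm hx.1.2))
        (hs.isClique hb hx.1.1 (Ne.symm hx.2))
    have hle := Set.ncard_le_ncard hsub
    rw [Set.ncard_coe_finset, hd a b hab,
      Finset.card_erase_of_mem (Finset.mem_erase.2 ⟨hab.ne', hb⟩),
      Finset.card_erase_of_mem ha, hs.card_eq] at hle
    omega
  · push Not at hex
    refine hfree.mono (Nat.le_succ _) s ⟨?_, hs.card_eq⟩
    intro a ha b hb hab
    exact (hs.isClique ha hb hab).resolve_right (hex a ha b hb)

/-- The cycle closed up by a new edge of `T` cannot be induced. -/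
theorem not_isInducedCycle_of_ends_adj (hH : IsChordal H) (hT : T.IsAcyclic)
    (hHT : ∀ u v, H.Adj u v → ¬ T.Reachable u v) (hfree : H.CliqueFree (d + 2))
    (hd : ∀ u v, T.Adj u v → (H.commonNeighbors u v).ncard = d)
    {J : SimpleGraph V} (hHJ : H ≤ J) (hJT : J ≤ H ⊔ T) (hJ : IsChordal J)
    {n : ℕ} (hn : 3 ≤ n) {q : ℕ → V} (hq : IsInducedPath J n q) (he : T.Adj (q 0) (q n)) :
    False := by
  classical
  have hTH : ∀ {a b}, T.Adj a b → ¬ H.Adj a b := fun h h' => hHT _ _ h' h.reachable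
  have hcne : ∀ c ∈ H.commonNeighbors (q 0) (q n), ∀ i ≤ n, c ≠ q i := by
    rintro c ⟨h0, h1⟩ i hi rfl
    simp only [SimpleGraph.mem_neighborSet] at h0 h1
    have hi0 : i ≠ 0 := by rintro rfl; exact h0.ne rfl
    have hin : i ≠ n := by rintro rfl; exact h1.ne rfl
    have a1 := (hq.adj_iff 0 i (by omega) hi).1 (hHJ h0)
    have a2 := (hq.adj_iff i n (by omega) le_rfl).1 (hHJ h1.symm)
    omega
  have hcJ : ∀ c ∈ H.commonNeighbors (q 0) (q n), ∀ i ≤ n, J.Adj c (q i) := fun c hc =>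
    hJ.adj_of_isInducedPath hq (hcne c hc) (hHJ hc.1.symm) (hHJ hc.2.symm)
  have hcH : ∀ c ∈ H.commonNeighbors (q 0) (q n), ∀ i ≤ n, H.Adj c (q i) := by
    intro c hc i hi
    refine (hJT (hcJ c hc i hi)).resolve_right fun hTi => ?_
    have hi0 : i ≠ 0 := by rintro rfl; exact hTH hTi hc.1.symm
    have hin : i ≠ n := by rintro rfl; exact hTH hTi hc.2.symm
    obtain ⟨k, rfl⟩ := Nat.exists_eq_succ_of_ne_zero hi0
    simp only [Nat.succ_eq_add_one] at *
    have hk : J.Adj (q (k + 1)) (q k) :=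
      ((hq.adj_iff k (k + 1) (by omega) (by omega)).2 rfl).symm
    have hk' : J.Adj (q (k + 1)) (q (k + 2)) :=
      (hq.adj_iff (k + 1) (k + 2) (by omega) (by omega)).2 rfl
    have e1 := adj_of_triangle hT hHT hTi (hJT (hcJ c hc k (by omega))) (hJT hk)
    have e2 := adj_of_triangle hT hHT hTi (hJT (hcJ c hc (k + 2) (by omega))) (hJT hk')
    refine hTH hTi (hH.adj_of_common (hq.ne k (k + 2) (by omega) (by omega)) (fun h => ?_)
      e1.1.symm e2.1.symm e1.2.symm e2.2.symm hTi.ne)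
    have := (hq.adj_iff k (k + 2) (by omega) (by omega)).1 (hHJ h)
    omega
  have hstep : ∀ j < n, T.Adj (q j) (q (j + 1)) := by
    intro j hj
    refine (hJT ((hq.adj_iff j (j + 1) (by omega) (by omega)).2 rfl)).resolve_left fun hHj => ?_
    have hfin := (H.commonNeighbors (q 0) (q n)).toFinite
    refine hfree (insert (q j) (insert (q (j + 1)) hfin.toFinset)) ⟨?_, ?_⟩
    · rw [Finset.coe_insert, Finset.coe_insert, hfin.coe_toFinset, SimpleGraph.isClique_insert,
        SimpleGraph.isClique_insert]
      refine ⟨⟨?_, fun b hb _ => (hcH b hb (j + 1) (by omega)).symm⟩, ?_⟩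
      · intro a ha b hb hab
        exact hH.adj_of_common he.ne (hTH he) ha.1 ha.2 hb.1 hb.2 hab
      · rintro b (rfl | hb) _
        · exact hHj
        · exact (hcH b hb j hj.le).symm
    · have h1 : q (j + 1) ∉ hfin.toFinset := by
        rw [hfin.mem_toFinset]
        exact fun h => hcne _ h (j + 1) (by omega) rfl
      have h2 : q j ∉ insert (q (j + 1)) hfin.toFinset := by
        rw [Finset.mem_insert, hfin.mem_toFinset]
        rintro (h | h)
        · exact hHj.ne h
        · exact hcne _ h j hj.le rfl
      rw [Finset.card_insert_of_notMem h2, Finset.card_insert_of_notMem h1,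
        ← Set.ncard_eq_toFinset_card _ hfin, hd _ _ he]
  refine SimpleGraph.isAcyclic_iff_forall_adj_isBridge.1 hT he ?_
  have hreach : ∀ j ≤ n, (T.deleteEdges {s(q 0, q n)}).Reachable (q 0) (q j) := by
    intro j
    induction j with
    | zero => intro _; exact .refl _
    | succ j ih =>
      intro hj
      refine (ih (by omega)).trans (SimpleGraph.Adj.reachable ?_)
      rw [SimpleGraph.deleteEdges_adj]
      refine ⟨hstep j hj, ?_⟩
      rw [Set.mem_singleton_iff, Sym2.eq_iff]
      rintro (⟨h1, h2⟩ | ⟨h1, h2⟩)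
      · rcases Nat.eq_zero_or_pos j with rfl | hj0
        · exact hq.ne (0 + 1) n (by omega) le_rfl h2
        · exact hq.ne 0 j hj0 (by omega) h1.symm
      · exact hq.ne 0 (j + 1) (by omega) hj h2.symm
  exact hreach n le_rfl

/-- Adding to a chordal graph `H` with clique number at most `d + 1` a forest that spans no edge
of `H` and whose edges have exactly `d` common neighbours in `H` preserves chordality. -/
theorem isChordal_sup (hH : IsChordal H) (hT : T.IsAcyclic)
    (hHT : ∀ u v, H.Adj u v → ¬ T.Reachable u v) (hfree : H.CliqueFree (d + 2))
    (hd : ∀ u v, T.Adj u v → (H.commonNeighbors u v).ncard = d) :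
    IsChordal (H ⊔ T) := by
  suffices h : IsChordal (H ⊔ SimpleGraph.fromEdgeSet T.edgeSet) by
    rwa [SimpleGraph.fromEdgeSet_edgeSet] at h
  refine Set.Finite.induction_on_subset
    (motive := fun S _ => IsChordal (H ⊔ SimpleGraph.fromEdgeSet S)) T.edgeSet
    (Set.toFinite _) (by simpa using hH) ?_
  intro e S he hS heS ih n p hp
  set J := H ⊔ SimpleGraph.fromEdgeSet S with hJ
  have hadj : ∀ {a b}, a ≠ b → ((H ⊔ SimpleGraph.fromEdgeSet (insert e S)).Adj a b ↔
      J.Adj a b ∨ s(a, b) = e) := by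
    intro a b hab
    simp only [hJ, SimpleGraph.sup_adj, SimpleGraph.fromEdgeSet_adj, Set.mem_insert_iff]
    tauto
  have h3 := hp.three_le
  have hex : ∃ q, IsInducedCycle (H ⊔ SimpleGraph.fromEdgeSet (insert e S)) n q ∧
      s(q 0, q n) = e := by
    by_contra hno
    refine ih n p ⟨h3, hp.ne, fun i j hij hj => ?_⟩
    rw [← hp.adj_iff i j hij hj, hadj (hp.ne i j hij hj)]
    refine ⟨Or.inl, fun h => h.resolve_right fun hije => hno ?_⟩
    rcases (hp.adj_iff i j hij hj).1 ((hadj (hp.ne i j hij hj)).2 (.inr hije)) with rfl | ⟨rfl, rfl⟩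
    · obtain ⟨q, hq, hqe⟩ := hp.exists_ends_eq (show i < n by omega)
      exact ⟨q, hq, hqe.trans hije⟩
    · exact ⟨p, hp, hije⟩
  obtain ⟨q, hq, rfl⟩ := hex
  have hJ0 : ¬ J.Adj (q 0) (q n) := by
    rintro (h | h)
    · exact hHT _ _ h (SimpleGraph.Adj.reachable he)
    · exact heS ((SimpleGraph.fromEdgeSet_adj _).1 h).1
  refine not_isInducedCycle_of_ends_adj hH hT hHT hfree hd (J := J) le_sup_left
    (sup_le_sup_left ?_ _) ih h3 ⟨hq.ne, fun i j hij hj => ?_⟩ he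
  · intro a b hab
    exact hS ((SimpleGraph.fromEdgeSet_adj _).1 hab).1
  · have h1 := hadj (hq.ne i j hij hj)
    rw [hq.adj_iff i j hij hj] at h1
    constructor
    · intro h
      refine (h1.2 (.inl h)).resolve_right ?_
      rintro ⟨rfl, rfl⟩
      exact hJ0 h
    · rintro rfl
      refine (h1.1 (.inl rfl)).resolve_right fun h => ?_
      rw [Sym2.eq_iff] at h
      rcases h with ⟨ha, hb⟩ | ⟨ha, hb⟩
      · rcases Nat.eq_zero_or_pos i with rfl | hi0
        · exact hq.ne (0 + 1) n (by omega) le_rfl hb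
        · exact hq.ne 0 i hi0 (by omega) ha.symm
      · exact hq.ne 0 (i + 1) (by omega) hj hb.symm

end Chordal

section Rank

variable {K E : Type*} [Field K] [AddCommGroup E] [Module K E]

theorem rank_empty : rank (∅ : Set (Submodule K E)) = 0 := by
  rw [rank, sInf_empty]
  exact Module.finrank_zero_of_subsingleton

theorem rank_insert_of_le (B : Set (Submodule K E)) {H : Submodule K E} (hH : sInf B ≤ H) :
    rank (insert H B) = rank B := by
  rw [rank, rank, sInf_insert, inf_eq_right.2 hH]

variable [FiniteDimensional K E]

theorem rank_insert_of_not_le (B : Set (Submodule K E)) {H : Submodule K E}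
    (h1 : Module.finrank K (E ⧸ H) = 1) (hH : ¬ sInf B ≤ H) :
    rank (insert H B) = rank B + 1 := by
  rw [rank, rank, sInf_insert]
  have hlt : H < H ⊔ sInf B := lt_of_le_of_ne le_sup_left fun h => hH (h ▸ le_sup_right)
  have e0 := Submodule.finrank_sup_add_finrank_inf_eq H (sInf B)
  have e1 := Submodule.finrank_quotient_add_finrank H
  have e2 := Submodule.finrank_quotient_add_finrank (sInf B)
  have e3 := Submodule.finrank_quotient_add_finrank (H ⊓ sInf B)
  have e4 := Submodule.finrank_lt_finrank_of_lt hlt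
  have e5 := Submodule.finrank_le (H ⊔ sInf B)
  omega

theorem rank_le_ncard {B : Set (Submodule K E)} (hfin : B.Finite)
    (h1 : ∀ H ∈ B, Module.finrank K (E ⧸ H) = 1) : rank B ≤ B.ncard := by
  refine Set.Finite.induction_on_subset (motive := fun S _ => rank S ≤ S.ncard) B hfin ?_ ?_
  · simp [rank_empty]
  · intro H S hH hS hHS ih
    rw [Set.ncard_insert_of_notMem hHS (hfin.subset hS)]
    by_cases hle : sInf S ≤ H
    · rw [rank_insert_of_le S hle]; omega
    · rw [rank_insert_of_not_le S (h1 H hH) hle]; omega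

/-- The hyperplanes in `B` are independent iff none of them contains the intersection of the
others. -/
theorem rank_eq_ncard_iff {B : Set (Submodule K E)} (hfin : B.Finite)
    (h1 : ∀ H ∈ B, Module.finrank K (E ⧸ H) = 1) :
    rank B = B.ncard ↔ ∀ H ∈ B, ¬ sInf (B \ {H}) ≤ H := by
  constructor
  · intro h H hH hle
    have e1 := rank_insert_of_le (B \ {H}) hle
    have e2 := rank_le_ncard (hfin.subset (Set.sdiff_subset (t := {H}))) fun H' h' => h1 H' h'.1
    have e3 := Set.ncard_sdiff_singleton_add_one hH hfin
    rw [Set.insert_sdiff_singleton, Set.insert_eq_of_mem hH] at e1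
    omega
  · intro h
    refine Set.Finite.induction_on_subset (motive := fun S _ => rank S = S.ncard) B hfin ?_ ?_
    · simp [rank_empty]
    · intro H S hH hS hHS ih
      rw [Set.ncard_insert_of_notMem hHS (hfin.subset hS), ← ih]
      refine rank_insert_of_not_le S (h1 H hH) fun hle => h H hH (le_trans (sInf_le_sInf ?_) hle)
      exact fun H' h' => ⟨hS h', fun h'' => hHS (h'' ▸ h')⟩

end Rank

section EdgeHyperplane

variable {V : Type*} (K : Type*) [Field K]

theorem mem_diagHyperplane {u v : V} {x : V → K} : x ∈ diagHyperplane K u v ↔ x u = x v := by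
  simp [diagHyperplane, sub_eq_zero]

/-- The hyperplane `x_u = x_v` attached to the unordered pair `s(u, v)`. -/
def edgeHyperplane : Sym2 V → Submodule K (V → K) :=
  Sym2.lift ⟨diagHyperplane K, fun u v => by
    ext x; rw [mem_diagHyperplane, mem_diagHyperplane, eq_comm]⟩

variable {K}

theorem mem_edgeHyperplane {u v : V} {x : V → K} :
    x ∈ edgeHyperplane K s(u, v) ↔ x u = x v := mem_diagHyperplane K

theorem eq_of_edgeHyperplane_le {a b c d : V} (hcd : c ≠ d)
    (h : ∀ x : V → K, x a = x b → x c = x d) : s(a, b) = s(c, d) := by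
  classical
  have h1 := h (Pi.single c 1)
  have h2 := h (Pi.single d 1)
  simp only [Pi.single_apply] at h1 h2
  simp only [hcd, hcd.symm, if_true, if_false, one_ne_zero, zero_ne_one, imp_false] at h1 h2
  rw [Sym2.eq_iff]
  by_cases ha : a = c <;> by_cases hb : b = c <;> by_cases ha' : a = d <;>
    by_cases hb' : b = d <;> simp_all

theorem edgeHyperplane_injOn : Set.InjOn (edgeHyperplane K) {e : Sym2 V | ¬ e.IsDiag} := by
  intro e he f hf h
  induction e with | _ a b
  induction f with | _ c d
  refine eq_of_edgeHyperplane_le (K := K) hf fun x hx => ?_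
  rw [← mem_edgeHyperplane, ← h, mem_edgeHyperplane]
  exact hx

theorem edgeHyperplane_injOn_edgeSet (G : SimpleGraph V) :
    Set.InjOn (edgeHyperplane K) G.edgeSet :=
  edgeHyperplane_injOn.mono fun _ he => G.not_isDiag_of_mem_edgeSet he

theorem finrank_quotient_edgeHyperplane {e : Sym2 V} (he : ¬ e.IsDiag) :
    Module.finrank K ((V → K) ⧸ edgeHyperplane K e) = 1 := by
  induction e with | _ a b
  exact finrank_quotient_diagHyperplane K he

theorem sInf_image_edgeHyperplane_le_iff {F : Set (Sym2 V)} {u v : V} :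
    sInf (edgeHyperplane K '' F) ≤ edgeHyperplane K s(u, v) ↔
      (SimpleGraph.fromEdgeSet F).Reachable u v := by
  classical
  constructor
  · intro h
    have hmem : (fun w => if (SimpleGraph.fromEdgeSet F).Reachable u w then (1 : K) else 0) ∈
        sInf (edgeHyperplane K '' F) := by
      rw [Submodule.mem_sInf]
      rintro _ ⟨e, he, rfl⟩
      induction e with | _ a b
      rw [mem_edgeHyperplane]
      rcases eq_or_ne a b with rfl | hab
      · rfl
      have hadj : (SimpleGraph.fromEdgeSet F).Adj a b := by
        rw [SimpleGraph.fromEdgeSet_adj]; exact ⟨he, hab⟩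
      simp only [show (SimpleGraph.fromEdgeSet F).Reachable u a ↔
        (SimpleGraph.fromEdgeSet F).Reachable u b from
        ⟨fun h => h.trans hadj.reachable, fun h => h.trans hadj.symm.reachable⟩]
    have := mem_edgeHyperplane.1 (h hmem)
    by_contra hno
    simp [hno] at this
  · rintro ⟨w⟩ x hx
    rw [mem_edgeHyperplane]
    induction w with
    | nil => rfl
    | cons hab _ ih =>
      refine Eq.trans ?_ ih
      exact mem_edgeHyperplane.1 ((Submodule.mem_sInf.1 hx) _
        ⟨_, ((SimpleGraph.fromEdgeSet_adj _).1 hab).1, rfl⟩)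

theorem rank_image_edgeHyperplane_iff [Finite V] {G : SimpleGraph V} {F : Set (Sym2 V)}
    (hF : F ⊆ G.edgeSet) :
    rank (edgeHyperplane K '' F) = (edgeHyperplane K '' F).ncard ↔
      (SimpleGraph.fromEdgeSet F).IsAcyclic := by
  have hnd : ∀ e ∈ F, ¬ e.IsDiag := fun e he => G.not_isDiag_of_mem_edgeSet (hF he)
  rw [rank_eq_ncard_iff (Set.toFinite _) (by
      rintro _ ⟨e, he, rfl⟩; exact finrank_quotient_edgeHyperplane (hnd e he)),
    SimpleGraph.isAcyclic_iff_forall_isBridge, Set.forall_mem_image]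
  have hE : (SimpleGraph.fromEdgeSet F).edgeSet = F := by
    rw [SimpleGraph.edgeSet_fromEdgeSet]
    ext e
    exact ⟨fun h => h.1, fun h => ⟨h, hnd e h⟩⟩
  rw [hE]
  refine forall₂_congr fun e he => not_iff_not.1 ?_
  have hdiff : edgeHyperplane K '' F \ {edgeHyperplane K e} = edgeHyperplane K '' (F \ {e}) := by
    rw [← Set.image_singleton, Set.InjOn.image_sdiff_subset
      ((edgeHyperplane_injOn_edgeSet G).mono hF) (Set.singleton_subset_iff.2 he)]
  rw [hdiff]
  induction e with | _ a b
  rw [SimpleGraph.isBridge_iff, not_not, not_not, sInf_image_edgeHyperplane_le_iff,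
    SimpleGraph.deleteEdges, SimpleGraph.fromEdgeSet_sdiff]

theorem exists_sInf_le_iff {G : SimpleGraph V} {F L : Set (Sym2 V)} (hL : L ⊆ G.edgeSet) :
    (∃ H ∈ edgeHyperplane K '' L, sInf (edgeHyperplane K '' F) ≤ H) ↔
      (edgeClosure G F ∩ L).Nonempty := by
  constructor
  · rintro ⟨_, ⟨e, he, rfl⟩, hle⟩
    induction e with | _ a b
    exact ⟨s(a, b), ⟨a, b, hL he, rfl, sInf_image_edgeHyperplane_le_iff.1 hle⟩, he⟩
  · rintro ⟨_, ⟨a, b, hab, rfl, hr⟩, he⟩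
    exact ⟨_, ⟨_, he, rfl⟩, sInf_image_edgeHyperplane_le_iff.2 hr⟩

theorem ncard_trianglesOver {G : SimpleGraph V} {L : Set (Sym2 V)} (hL : L ⊆ G.edgeSet) {u v : V}
    (huv : G.Adj u v) :
    (trianglesOver G L s(u, v)).ncard =
      ((SimpleGraph.fromEdgeSet L).commonNeighbors u v).ncard := by
  classical
  have hmem : ∀ w, w ∈ (SimpleGraph.fromEdgeSet L).commonNeighbors u v ↔
      s(u, w) ∈ L ∧ s(v, w) ∈ L := by
    intro w
    rw [SimpleGraph.mem_commonNeighbors, SimpleGraph.fromEdgeSet_adj, SimpleGraph.fromEdgeSet_adj]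
    exact ⟨fun h => ⟨h.1.1, h.2.1⟩, fun h => ⟨⟨h.1, (hL h.1).ne⟩, ⟨h.2, (hL h.2).ne⟩⟩⟩
  symm
  refine Set.ncard_congr (fun w _ => ({u, v, w} : Finset V)) ?_ ?_ ?_
  · intro w hw
    rw [hmem] at hw
    have h1 : G.Adj u w := hL hw.1
    have h2 : G.Adj v w := hL hw.2
    refine ⟨SimpleGraph.is3Clique_triple_iff.2 ⟨huv, h1, h2⟩, ?_, ?_⟩
    · intro a ha
      rcases Sym2.mem_iff.1 ha with rfl | rfl <;> simp
    · intro a ha b hb hab hne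
      simp only [Finset.mem_insert, Finset.mem_singleton] at ha hb
      have hw1 : s(w, u) ∈ L := Sym2.eq_swap ▸ hw.1
      have hw2 : s(w, v) ∈ L := Sym2.eq_swap ▸ hw.2
      rcases ha with rfl | rfl | rfl <;> rcases hb with rfl | rfl | rfl <;>
        first
          | exact absurd rfl hab
          | exact absurd rfl hne
          | exact absurd Sym2.eq_swap hne
          | exact hw.1
          | exact hw.2
          | assumption
  · intro a b ha hb hab
    rw [hmem] at ha hb
    have : a ∈ ({u, v, b} : Finset V) := hab ▸ (by simp : a ∈ ({u, v, a} : Finset V))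
    simp only [Finset.mem_insert, Finset.mem_singleton] at this
    rcases this with h | h | h
    · exact absurd h.symm (hL ha.1).ne
    · exact absurd h.symm (hL ha.2).ne
    · exact h
  · rintro t ⟨h3, hsub, hedge⟩
    have hu : u ∈ t := hsub u (by simp)
    have hv : v ∈ t := hsub v (by simp)
    have hcard : ((t.erase u).erase v).card = 1 := by
      rw [Finset.card_erase_of_mem (Finset.mem_erase.2 ⟨huv.ne', hv⟩),
        Finset.card_erase_of_mem hu, h3.card_eq]
    obtain ⟨w, hw⟩ := Finset.card_eq_one.1 hcard
    have hwt : w ∈ (t.erase u).erase v := by rw [hw]; simp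
    simp only [Finset.mem_erase] at hwt
    refine ⟨w, (hmem w).2 ⟨hedge u hu w hwt.2.2 hwt.2.1.symm ?_,
      hedge v hv w hwt.2.2 hwt.1.symm ?_⟩, ?_⟩
    · rw [Ne, Sym2.eq_iff]
      rintro (⟨_, h⟩ | ⟨h, _⟩)
      · exact hwt.1 h
      · exact huv.ne h
    · rw [Ne, Sym2.eq_iff]
      rintro (⟨h, _⟩ | ⟨_, h⟩)
      · exact huv.ne h.symm
      · exact hwt.2.1 h
    · rw [← Finset.insert_erase hu, ← Finset.insert_erase (Finset.mem_erase.2 ⟨huv.ne', hv⟩), hw]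

/-- Contracting `v` to `u` identifies two edges exactly for each common neighbour of `u, v`. -/
theorem ncard_image_contract_add [Finite V] [DecidableEq V] {L : Set (Sym2 V)}
    (hL : ∀ e ∈ L, ¬ e.IsDiag) {u v : V} (huv : u ≠ v) :
    (Sym2.map (fun w => if w = v then u else w) '' L).ncard +
      ((SimpleGraph.fromEdgeSet L).commonNeighbors u v).ncard = L.ncard := by
  set σ : V → V := fun w => if w = v then u else w with hσ
  set C := (SimpleGraph.fromEdgeSet L).commonNeighbors u v with hC
  have hCmem : ∀ w, w ∈ C ↔ s(u, w) ∈ L ∧ s(v, w) ∈ L := by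
    intro w
    rw [hC, SimpleGraph.mem_commonNeighbors, SimpleGraph.fromEdgeSet_adj,
      SimpleGraph.fromEdgeSet_adj]
    exact ⟨fun h => ⟨h.1.1, h.2.1⟩, fun h => ⟨⟨h.1, hL _ h.1⟩, ⟨h.2, hL _ h.2⟩⟩⟩
  set N : Set (Sym2 V) := (fun w => s(v, w)) '' C with hN
  have hNL : N ⊆ L := by
    rintro _ ⟨w, hw, rfl⟩
    exact ((hCmem w).1 hw).2
  have hNcard : N.ncard = C.ncard :=
    Set.ncard_image_of_injective _ fun a b h => Sym2.congr_right.1 h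
  have himg : Sym2.map σ '' L = Sym2.map σ '' (L \ N) := by
    refine subset_antisymm ?_ (Set.image_mono Set.sdiff_subset)
    rintro _ ⟨e, heL, rfl⟩
    by_cases heN : e ∈ N
    · obtain ⟨w, hw, rfl⟩ := heN
      have hw' := (hCmem w).1 hw
      have hwv : w ≠ v := fun h => hL _ hw'.2 h.symm
      have hwu : w ≠ u := fun h => hL _ hw'.1 h.symm
      refine ⟨s(u, w), ⟨hw'.1, ?_⟩, ?_⟩
      · rintro ⟨x, hx, hxe⟩
        simp only [Sym2.eq_iff] at hxe
        rcases hxe with ⟨h, _⟩ | ⟨h, _⟩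
        · exact huv h.symm
        · exact hwv h.symm
      · simp [hσ, hwv, huv]
    · exact ⟨e, ⟨heL, heN⟩, rfl⟩
  have hfix : ∀ e : Sym2 V, v ∉ e → Sym2.map σ e = e := by
    intro e hve
    induction e with | _ a b
    rw [Sym2.mem_iff, not_or] at hve
    simp [hσ, Ne.symm hve.1, Ne.symm hve.2]
  have hmv : ∀ w, s(v, w) ∈ L → Sym2.map σ s(v, w) = s(u, w) := by
    intro w hw
    have hwv : w ≠ v := fun h => hL _ hw h.symm
    simp [hσ, hwv]
  have hout : ∀ w, s(v, w) ∈ L \ N → s(u, w) ∉ L := fun w hw huw =>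
    hw.2 ⟨w, (hCmem w).2 ⟨huw, hw.1⟩, rfl⟩
  have hinj : Set.InjOn (Sym2.map σ) (L \ N) := by
    intro e he f hf hef
    by_cases hve : v ∈ e <;> by_cases hvf : v ∈ f
    · obtain ⟨w, rfl⟩ := hve
      obtain ⟨x, rfl⟩ := hvf
      rw [hmv w he.1, hmv x hf.1, Sym2.congr_right] at hef
      rw [hef]
    · obtain ⟨w, rfl⟩ := hve
      rw [hmv w he.1, hfix f hvf] at hef
      exact absurd (hef ▸ hf.1) (hout w he)
    · obtain ⟨w, rfl⟩ := hvf
      rw [hmv w hf.1, hfix e hve] at hef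
      exact absurd (hef ▸ he.1) (hout w hf)
    · rwa [hfix e hve, hfix f hvf] at hef
  rw [himg, hinj.ncard_image, ← hNcard, Set.ncard_sdiff_add_ncard_of_subset hNL]

theorem restriction_edgeHyperplane {L : Set (Sym2 V)} (hL : ∀ e ∈ L, ¬ e.IsDiag) {e : Sym2 V}
    (hed : ¬ e.IsDiag) (he : e ∉ L) :
    restriction (edgeHyperplane K '' L ∪ {edgeHyperplane K e}) (edgeHyperplane K e) =
      (fun f => edgeHyperplane K f ⊓ edgeHyperplane K e) '' L := by
  have hne : ∀ f ∈ L, ¬ edgeHyperplane K e ≤ edgeHyperplane K f := by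
    intro f hf hle
    refine he ?_
    have hfd := hL f hf
    induction e with | _ a b
    induction f with | _ c d
    rwa [eq_of_edgeHyperplane_le (K := K) hfd fun x hx =>
      mem_edgeHyperplane.1 (hle (mem_edgeHyperplane.2 hx))]
  rw [restriction, ← Set.image_image (fun H => H ⊓ edgeHyperplane K e) (edgeHyperplane K)]
  congr 1
  ext H
  constructor
  · rintro ⟨hH | rfl, hnot⟩
    · exact hH
    · exact absurd ⟨Or.inr rfl, le_rfl⟩ hnot
  · rintro ⟨f, hf, rfl⟩
    exact ⟨Or.inl ⟨f, hf, rfl⟩, fun h => hne f hf h.2⟩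

theorem ncard_sub_ncard_restriction [Finite V] {G : SimpleGraph V} {L : Set (Sym2 V)}
    (hL : L ⊆ G.edgeSet) {e : Sym2 V} (heG : e ∈ G.edgeSet) (he : e ∉ L) :
    ((edgeHyperplane K '' L).ncard : ℤ) -
      ((restriction (edgeHyperplane K '' L ∪ {edgeHyperplane K e})
        (edgeHyperplane K e)).ncard : ℤ) = ((trianglesOver G L e).ncard : ℤ) := by
  classical
  have hnd : ∀ e ∈ L, ¬ e.IsDiag := fun e he => G.not_isDiag_of_mem_edgeSet (hL he)
  rw [restriction_edgeHyperplane hnd (G.not_isDiag_of_mem_edgeSet heG) he,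
    ((edgeHyperplane_injOn_edgeSet G).mono hL).ncard_image]
  induction e with | _ u v
  have huv : G.Adj u v := heG
  rw [ncard_trianglesOver hL huv, ← ncard_image_contract_add hnd huv.ne]
  set σ : V → V := fun w => if w = v then u else w with hσ
  have hσv : ∀ w, σ w ≠ v := by
    intro w
    by_cases hw : w = v <;> simp [hσ, hw, huv.ne]
  have hσfix : ∀ {w}, w ≠ v → σ w = w := fun hw => by simp [hσ, hw]
  have himg : (fun f => edgeHyperplane K f ⊓ edgeHyperplane K s(u, v)) '' L =
      (fun f => edgeHyperplane K f ⊓ edgeHyperplane K s(u, v)) '' (Sym2.map σ '' L) := by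
    rw [Set.image_image]
    refine Set.image_congr fun f _ => ?_
    induction f with | _ a b
    ext x
    simp only [Submodule.mem_inf, Sym2.map_mk, mem_edgeHyperplane]
    refine and_congr_left fun hx => ?_
    have : ∀ w, x (σ w) = x w := by
      intro w
      by_cases hw : w = v <;> simp [hσ, hw, hx]
    rw [this, this]
  have hinj : Set.InjOn (fun f => edgeHyperplane K f ⊓ edgeHyperplane K s(u, v))
      (Sym2.map σ '' L) := by
    rintro _ ⟨f, hf, rfl⟩ _ ⟨g, hg, rfl⟩ hfg
    induction f with | _ a b
    induction g with | _ c d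
    simp only [Sym2.map_mk] at hfg ⊢
    have hcd : σ c ≠ σ d := by
      intro h
      have hne : c ≠ d := hnd _ hg
      by_cases hc : c = v <;> by_cases hd : d = v
      · exact hne (hc.trans hd.symm)
      · subst hc
        rw [hσfix hd] at h
        refine he ?_
        rw [← h] at hg
        simpa [hσ, Sym2.eq_swap] using hg
      · subst hd
        rw [hσfix hc] at h
        refine he ?_
        rw [h] at hg
        simpa [hσ] using hg
      · rw [hσfix hc, hσfix hd] at h
        exact hne h
    refine eq_of_edgeHyperplane_le (K := K) hcd fun x hx => ?_
    have hmem : (fun w => x (σ w)) ∈ edgeHyperplane K s(σ a, σ b) ⊓ edgeHyperplane K s(u, v) := by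
      rw [Submodule.mem_inf, mem_edgeHyperplane, mem_edgeHyperplane]
      refine ⟨?_, ?_⟩
      · rw [hσfix (hσv a), hσfix (hσv b)]
        exact hx
      · simp [hσ]
    rw [hfg, Submodule.mem_inf, mem_edgeHyperplane] at hmem
    have := hmem.1
    rwa [hσfix (hσv c), hσfix (hσv d)] at this
  rw [himg, hinj.ncard_image]
  push_cast
  ring

theorem hyperplanes_graphicArrangement [Finite V] (G : SimpleGraph V) :
    (graphicArrangement K G).hyperplanes = edgeHyperplane K '' G.edgeSet := by
  ext H
  constructor
  · rintro ⟨u, v, huv, rfl⟩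
    exact ⟨s(u, v), huv, rfl⟩
  · rintro ⟨e, he, rfl⟩
    induction e with | _ u v
    exact ⟨u, v, he, rfl⟩

end EdgeHyperplane

section Labelings

variable {V : Type*} {G : SimpleGraph V} {lam : G.edgeSet → ℕ+}

theorem mem_labelClass {k : ℕ+} {e : Sym2 V} :
    e ∈ labelClass lam k ↔ ∃ h : e ∈ G.edgeSet, lam ⟨e, h⟩ = k := by
  simp [labelClass]

theorem mem_lowerEdges {k : ℕ+} {e : Sym2 V} :
    e ∈ lowerEdges lam k ↔ ∃ h : e ∈ G.edgeSet, lam ⟨e, h⟩ < k := by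
  simp only [lowerEdges, Set.mem_iUnion, mem_labelClass]
  constructor
  · rintro ⟨j, hj, h, rfl⟩
    exact ⟨h, hj⟩
  · rintro ⟨h, hlt⟩
    exact ⟨_, hlt, h, rfl⟩

theorem labelClass_subset (k : ℕ+) : labelClass lam k ⊆ G.edgeSet := fun _ he =>
  (mem_labelClass.1 he).1

theorem lowerEdges_subset (k : ℕ+) : lowerEdges lam k ⊆ G.edgeSet := fun _ he =>
  (mem_lowerEdges.1 he).1

theorem notMem_lowerEdges {k : ℕ+} {e : Sym2 V} (he : e ∈ labelClass lam k) :
    e ∉ lowerEdges lam k := by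
  obtain ⟨_, rfl⟩ := mem_labelClass.1 he
  intro h
  obtain ⟨_, h⟩ := mem_lowerEdges.1 h
  exact lt_irrefl _ h

theorem lowerEdges_succPNat_succ (d : ℕ) :
    lowerEdges lam (d + 1).succPNat =
      lowerEdges lam d.succPNat ∪ labelClass lam d.succPNat := by
  ext e
  simp only [Set.mem_union, mem_lowerEdges, mem_labelClass, ← exists_or, ← le_iff_lt_or_eq]
  refine exists_congr fun h => ?_
  rw [← PNat.coe_lt_coe, ← PNat.coe_le_coe, Nat.succPNat_coe, Nat.succPNat_coe]
  omega

variable [Finite V]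

/-- The edges of label at most `d` form a chordal graph of clique number at most `d + 1`. -/
theorem IsMATLabeling.isChordal_and_cliqueFree (h : IsMATLabeling G lam) (d : ℕ) :
    IsChordal (SimpleGraph.fromEdgeSet (lowerEdges lam d.succPNat)) ∧
      (SimpleGraph.fromEdgeSet (lowerEdges lam d.succPNat)).CliqueFree (d + 2) := by
  induction d with
  | zero =>
    have h0 : lowerEdges lam (0 : ℕ).succPNat = ∅ := by
      refine Set.eq_empty_of_forall_notMem fun e he => ?_
      obtain ⟨_, hlt⟩ := mem_lowerEdges.1 he
      exact not_lt_one hlt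
    rw [h0, SimpleGraph.fromEdgeSet_empty]
    exact ⟨isChordal_bot, SimpleGraph.cliqueFree_bot le_rfl⟩
  | succ d ih =>
    rw [lowerEdges_succPNat_succ, SimpleGraph.fromEdgeSet_union]
    have hHT : ∀ u v, (SimpleGraph.fromEdgeSet (lowerEdges lam d.succPNat)).Adj u v →
        ¬ (SimpleGraph.fromEdgeSet (labelClass lam d.succPNat)).Reachable u v := by
      intro u v huv hr
      have hmem := ((SimpleGraph.fromEdgeSet_adj _).1 huv).1
      exact Set.eq_empty_iff_forall_notMem.1 (h.ml2 d.succPNat) s(u, v)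
        ⟨⟨u, v, lowerEdges_subset _ hmem, rfl, hr⟩, hmem⟩
    have hd : ∀ u v, (SimpleGraph.fromEdgeSet (labelClass lam d.succPNat)).Adj u v →
        ((SimpleGraph.fromEdgeSet (lowerEdges lam d.succPNat)).commonNeighbors u v).ncard = d := by
      intro u v huv
      have hmem := ((SimpleGraph.fromEdgeSet_adj _).1 huv).1
      rw [← ncard_trianglesOver (lowerEdges_subset _) (labelClass_subset _ hmem),
        h.ml3 _ _ hmem, Nat.succPNat_coe, Nat.succ_sub_one]
    exact ⟨isChordal_sup ih.1 (h.ml1 _) hHT ih.2 hd, cliqueFree_sup (h.ml1 _) hHT ih.2 hd⟩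

/-- The labels used by an MAT-labeling form an initial segment. -/
theorem IsMATLabeling.exists_label_eq (h : IsMATLabeling G lam) {e : G.edgeSet} {d : ℕ}
    (hde : d.succPNat ≤ lam e) : ∃ f, lam f = d.succPNat := by
  by_contra hno
  push Not at hno
  obtain ⟨f, hf, hmin⟩ := Set.exists_min_image {f | d.succPNat ≤ lam f} lam (Set.toFinite _)
    ⟨e, hde⟩
  have hlt : d.succPNat < lam f := lt_of_le_of_ne hf (hno f).symm
  have hlow : lowerEdges lam (lam f) = lowerEdges lam d.succPNat := by
    ext g
    rw [mem_lowerEdges, mem_lowerEdges]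
    refine exists_congr fun hg => ⟨fun hgf => ?_, fun hgd => hgd.trans hlt⟩
    by_contra hge
    exact (hmin ⟨g, hg⟩ (not_lt.1 hge)).not_gt hgf
  have hfc : f.1 ∈ labelClass lam (lam f) := mem_labelClass.2 ⟨f.2, rfl⟩
  have hf3 := h.ml3 _ _ hfc
  have hfn := notMem_lowerEdges hfc
  rw [hlow] at hf3 hfn
  have hcoe : d + 1 < (lam f : ℕ) := by simpa using PNat.coe_lt_coe _ _ |>.2 hlt
  obtain ⟨hch, hfree⟩ := h.isChordal_and_cliqueFree d
  obtain ⟨⟨u, v⟩, huv⟩ := f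
  have hadj : G.Adj u v := huv
  change (trianglesOver G _ s(u, v)).ncard = _ at hf3
  rw [ncard_trianglesOver (lowerEdges_subset _) hadj] at hf3
  have := hch.ncard_commonNeighbors_le hfree hadj.ne fun h' =>
    hfn ((SimpleGraph.fromEdgeSet_adj _).1 h').1
  omega

end Labelings

section Equivalence

variable {V : Type*} [Finite V] {G : SimpleGraph V} {K : Type*} [Field K]

theorem IsMATLabeling.isMATFree {lam : G.edgeSet → ℕ+} (h : IsMATLabeling G lam) :
    (graphicArrangement K G).IsMATFree := by
  rcases isEmpty_or_nonempty G.edgeSet with hE | hE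
  · left
    rw [hyperplanes_graphicArrangement, Set.isEmpty_coe_sort.1 hE, Set.image_empty]
  obtain ⟨e, hmax⟩ := Finite.exists_max lam
  have hinj := edgeHyperplane_injOn_edgeSet (K := K) G
  have hlower : ∀ k : Fin (lam e),
      lowerBlocks (fun k : Fin (lam e) => edgeHyperplane K '' labelClass lam (k : ℕ).succPNat) k =
        edgeHyperplane K '' lowerEdges lam (k : ℕ).succPNat := by
    intro k
    ext H
    simp only [lowerBlocks, Set.mem_iUnion]
    constructor
    · rintro ⟨j, hj, f, hf, rfl⟩
      obtain ⟨hfG, hf⟩ := mem_labelClass.1 hf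
      exact ⟨f, mem_lowerEdges.2 ⟨hfG, hf ▸ Nat.succPNat_lt_succPNat.2 hj⟩, rfl⟩
    · rintro ⟨f, hf, rfl⟩
      obtain ⟨hfG, hf⟩ := mem_lowerEdges.1 hf
      have hlt := PNat.coe_lt_coe _ _ |>.2 hf
      rw [Nat.succPNat_coe] at hlt
      have hpos := (lam ⟨f, hfG⟩).pos
      refine ⟨⟨(lam ⟨f, hfG⟩ : ℕ) - 1, by omega⟩, Fin.lt_def.2 (by simp only; omega), f,
        mem_labelClass.2 ⟨hfG, ?_⟩, rfl⟩
      apply PNat.eq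
      rw [Nat.succPNat_coe]
      simp only
      omega
  right
  refine ⟨lam e, fun k => edgeHyperplane K '' labelClass lam (k : ℕ).succPNat,
    ⟨?_, ?_, ?_, ?_, ?_, ?_⟩⟩
  · intro k
    obtain ⟨f, hf⟩ := h.exists_label_eq (e := e) (d := k) (by
      rw [← PNat.coe_le_coe, Nat.succPNat_coe]; exact k.2)
    exact ⟨_, f.1, mem_labelClass.2 ⟨f.2, hf⟩, rfl⟩
  · intro j k hjk
    rw [Set.disjoint_left]
    rintro _ ⟨f, hf, rfl⟩ ⟨g, hg, hgf⟩
    obtain ⟨hfG, hf⟩ := mem_labelClass.1 hf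
    obtain ⟨hgG, hg⟩ := mem_labelClass.1 hg
    obtain rfl := hinj hgG hfG hgf
    exact hjk (Fin.ext (Nat.succPNat_injective (hf.symm.trans hg)))
  · rw [hyperplanes_graphicArrangement, ← Set.image_iUnion]
    congr 1
    ext f
    rw [Set.mem_iUnion]
    refine ⟨fun ⟨k, hk⟩ => labelClass_subset _ hk, fun hf => ?_⟩
    have hle : (lam ⟨f, hf⟩ : ℕ) ≤ lam e := hmax ⟨f, hf⟩
    have hpos := (lam ⟨f, hf⟩).pos
    refine ⟨⟨(lam ⟨f, hf⟩ : ℕ) - 1, by omega⟩, mem_labelClass.2 ⟨hf, PNat.eq ?_⟩⟩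
    rw [Nat.succPNat_coe]
    simp only
    omega
  · intro k
    exact (rank_image_edgeHyperplane_iff (labelClass_subset _)).2 (h.ml1 _)
  · intro k
    rw [hlower, exists_sInf_le_iff (lowerEdges_subset _), h.ml2]
    exact Set.not_nonempty_empty
  · rintro k _ ⟨f, hf, rfl⟩
    rw [hlower, ncard_sub_ncard_restriction (lowerEdges_subset _) (labelClass_subset _ hf)
      (notMem_lowerEdges hf), h.ml3 _ _ hf, Nat.succPNat_coe, Nat.succ_sub_one]

theorem IsMATPartition.exists_isMATLabeling {n : ℕ} {π : Fin n → Set (Submodule K (V → K))}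
    (h : IsMATPartition (graphicArrangement K G) π) :
    ∃ lam : G.edgeSet → ℕ+, IsMATLabeling G lam := by
  have hcover := h.cover
  rw [hyperplanes_graphicArrangement] at hcover
  have hex : ∀ e : G.edgeSet, ∃ k, edgeHyperplane K e.1 ∈ π k := fun e =>
    Set.mem_iUnion.1 (hcover ▸ Set.mem_image_of_mem _ e.2)
  choose idx hidx using hex
  have huniq : ∀ {e : G.edgeSet} {k}, edgeHyperplane K e.1 ∈ π k → idx e = k := by
    intro e k hk
    by_contra hne
    exact Set.disjoint_left.1 (h.disjoint _ _ hne) (hidx e) hk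
  set lam : G.edgeSet → ℕ+ := fun e => (idx e : ℕ).succPNat with hlam
  have hblock : ∀ k : Fin n, edgeHyperplane K '' labelClass lam (k : ℕ).succPNat = π k := by
    intro k
    ext H
    constructor
    · rintro ⟨e, he, rfl⟩
      obtain ⟨heG, he⟩ := mem_labelClass.1 he
      have : idx ⟨e, heG⟩ = k := Fin.ext (Nat.succPNat_injective he)
      exact this ▸ hidx ⟨e, heG⟩
    · intro hH
      obtain ⟨e, he, rfl⟩ := hcover ▸ Set.mem_iUnion.2 ⟨k, hH⟩
      exact ⟨e, mem_labelClass.2 ⟨he, by rw [hlam]; simp only; rw [huniq (e := ⟨e, he⟩) hH]⟩, rfl⟩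
  have hlower : ∀ k : Fin n,
      edgeHyperplane K '' lowerEdges lam (k : ℕ).succPNat = lowerBlocks π k := by
    intro k
    ext H
    simp only [lowerBlocks, Set.mem_iUnion]
    constructor
    · rintro ⟨e, he, rfl⟩
      obtain ⟨heG, he⟩ := mem_lowerEdges.1 he
      exact ⟨idx ⟨e, heG⟩, Nat.succPNat_lt_succPNat.1 he, hidx ⟨e, heG⟩⟩
    · rintro ⟨j, hj, hH⟩
      rw [← hblock j] at hH
      obtain ⟨e, he, rfl⟩ := hH
      obtain ⟨heG, he⟩ := mem_labelClass.1 he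
      exact ⟨e, mem_lowerEdges.2 ⟨heG, he ▸ Nat.succPNat_lt_succPNat.2 hj⟩, rfl⟩
  have hcases : ∀ k : ℕ+, (∃ i : Fin n, k = (i : ℕ).succPNat) ∨ labelClass lam k = ∅ := by
    intro k
    rcases Set.eq_empty_or_nonempty (labelClass lam k) with hk | ⟨e, he⟩
    · exact .inr hk
    · obtain ⟨heG, he⟩ := mem_labelClass.1 he
      exact .inl ⟨idx ⟨e, heG⟩, he.symm⟩
  refine ⟨lam, ⟨fun k => ?_, fun k => ?_, fun k e he => ?_⟩⟩
  · rcases hcases k with ⟨i, rfl⟩ | hk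
    · rw [← rank_image_edgeHyperplane_iff (K := K) (labelClass_subset _), hblock]
      exact h.mp1 i
    · rw [hk, SimpleGraph.fromEdgeSet_empty]
      exact SimpleGraph.isAcyclic_bot
  · rcases hcases k with ⟨i, rfl⟩ | hk
    · rw [← Set.not_nonempty_iff_eq_empty, ← exists_sInf_le_iff (K := K) (lowerEdges_subset _),
        hblock, hlower]
      exact h.mp2 i
    · refine Set.eq_empty_of_forall_notMem ?_
      rintro _ ⟨⟨u, v, huv, rfl, hr⟩, _⟩
      rw [hk, SimpleGraph.fromEdgeSet_empty, SimpleGraph.reachable_bot] at hr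
      exact huv.ne hr
  · rcases hcases k with ⟨i, rfl⟩ | hk
    · have h3 := h.mp3 i (edgeHyperplane K e) (hblock i ▸ Set.mem_image_of_mem _ he)
      rw [← hlower, ncard_sub_ncard_restriction (lowerEdges_subset _) (labelClass_subset _ he)
        (notMem_lowerEdges he)] at h3
      rw [Nat.succPNat_coe, Nat.succ_sub_one]
      exact_mod_cast h3
    · rw [hk] at he
      exact absurd he (Set.notMem_empty e)

end Equivalence

end MATFree

theorem proposition4p3 (K : Type*) [Field K] {V : Type*} [Finite V] (G : SimpleGraph V) :
    (MATFree.graphicArrangement K G).IsMATFree ↔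
      ∃ lam : G.edgeSet → ℕ+, MATFree.IsMATLabeling G lam := by
  refine ⟨?_, fun ⟨lam, h⟩ => h.isMATFree⟩
  rintro (h | ⟨n, π, h⟩)
  · rw [MATFree.hyperplanes_graphicArrangement, Set.image_eq_empty] at h
    have hnone : ∀ lam : G.edgeSet → ℕ+, ∀ k, MATFree.labelClass lam k = ∅ := fun lam k =>
      Set.subset_empty_iff.1 (h ▸ MATFree.labelClass_subset k)
    refine ⟨fun _ => 1, ⟨fun k => ?_, fun k => ?_, fun k e he => ?_⟩⟩
    · rw [hnone, SimpleGraph.fromEdgeSet_empty]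
      exact SimpleGraph.isAcyclic_bot
    · exact Set.subset_empty_iff.1
        (Set.inter_subset_right.trans (h ▸ MATFree.lowerEdges_subset k))
    · rw [hnone] at he
      exact absurd he (Set.notMem_empty e)
  · exact h.exists_isMATLabeling
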